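/- Let $\mathbb K$ be a field of characteristic $0$, let $\mathfrak m=\sum_{p<0}\mathfrak g_p$ be a finite-dimensional $\mathbb Z$-graded nilpotent Lie algebra over $\mathbb K$ all of whose homogeneous components of degree $\ge 0$ are zero, and let $\mathfrak g_0$ be a Lie subalgebra of the Lie algebra of derivations of $\mathfrak m$ that are homogeneous of degree $0$ (i.e. $D(\mathfrak g_p)\subseteq\mathfrak g_p$ for all $p<0$). Write $\rho(X)\in\mathfrak{gl}_{\mathbb K}(\mathfrak m)$ for the action of $X\in\mathfrak g_0$ on $\mathfrak m$. A *prolongation of type $\mathfrak g_0$ of $\mathfrak m$* is a $\mathbb Z$-graded Lie algebra $\mathfrak g=\sum_{p\in\mathbb Z}\mathfrak g_p$ over $\mathbb K$ that contains $\mathfrak m$ and $\mathfrak g_0$ as Lie subalgebras, whose homogeneous component of degree $p$ is that of $\mathfrak m$ for each $p<0$ and is $\mathfrak g_0$ for $p=0$, and in which $[X,Y]=X(Y)$ for $X\in\mathfrak g_0$ and $Y\in\mathfrak m$. It is *almost effective* if the only $X\in\sum_{p\ge 0}\mathfrak g_p$ with $[X,\mathfrak m]=\{0\}$ is $X=0$.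 Let $\mathfrak g$ be a finite-dimensional almost effective prolongation of type $\mathfrak g_0$ of $\mathfrak m$, let $\mathfrak n(\mathfrak g)$ be its maximal nilpotent ideal (the largest ideal that is nilpotent as a Lie algebra), let $\mathfrak r$ be its solvable radical and let $\mathfrak r_0=\mathfrak r\cap\mathfrak g_0$. Then $$\mathfrak n(\mathfrak g)\cap\mathfrak g_0=\{X\in\mathfrak r_0\mid \rho(X)\text{ is nilpotent on }\mathfrak m\}=\{X\in\operatorname{rad}(\mathfrak g_0)\mid \rho(X)\text{ is nilpotent on }\mathfrak m\},$$ where $\operatorname{rad}(\mathfrak g_0)$ is the solvable radical of $\mathfrak g_0$. In particular $\mathfrak n(\mathfrak g)\cap\mathfrak g_0$ depends only on $\mathfrak m$ and $\mathfrak g_0$: if $\mathfrak g'$ is another finite-dimensional almost effective prolongation of type $\mathfrak g_0$ of $\mathfrak m$, then $\mathfrak n(\mathfrak g')\cap\mathfrak g_0=\mathfrak n(\mathfrak g)\cap\mathfrak g_0$. -/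

import Mathlib

/-- The maximal nilpotent ideal (nilradical) of a Lie algebra `L`: the sum of all ideals of `L`
that are nilpotent as Lie algebras.  (Mathlib's `LieAlgebra.maxNilpotentIdeal` is a different
object: it asks for ideals that are nilpotent as `L`-modules under the adjoint action.) -/
def nilradicalIdeal (K L : Type*) [CommRing K] [LieRing L] [LieAlgebra K L] : LieIdeal K L :=
  sSup {I : LieIdeal K L | LieRing.IsNilpotent I}

theorem lie_iSup_le {K L : Type*} [Field K] [LieRing L] [LieAlgebra K L] {ι : Sort*}
    {A T : LieIdeal K L} {N : ι → LieIdeal K L}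
    (h : ∀ i, ⁅A, N i⁆ ≤ T) : ⁅A, ⨆ i, N i⁆ ≤ T := by
  rw [LieSubmodule.lie_le_iff]
  intro x hx y hy
  induction hy using LieSubmodule.iSup_induction' with
  | mem i z hz => exact h i (LieSubmodule.lie_mem_lie hx hz)
  | zero => simp
  | add y z _ _ hy hz => rw [lie_add]; exact add_mem hy hz

section NilradicalFacts

variable {K L : Type*} [Field K] [LieRing L] [LieAlgebra K L] [FiniteDimensional K L]

/-- An ideal is nilpotent as a Lie algebra iff it acts nilpotently on the whole Lie algebra. -/
theorem idealNilpotent_iff_lcs (I : LieIdeal K L) :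
    LieRing.IsNilpotent I ↔ ∃ k, I.lcs L k = ⊥ := by
  have key : LieRing.IsNilpotent I ↔ LieModule.IsNilpotent I L := by
    rw [LieAlgebra.isNilpotent_iff_forall (R := K), LieModule.isNilpotent_iff_forall' (R := K)]
    constructor
    · intro h x
      obtain ⟨n, hn⟩ := h x
      refine ⟨n + 1, ?_⟩
      have aux : ∀ (k : ℕ) (y : I), ((LieModule.toEnd K I L x) ^ k) (y : L)
          = (((LieAlgebra.ad K I x) ^ k) y : I) := by
        intro k
        induction k with
        | zero => intro y; simp
        | succ k ih => intro y; rw [pow_succ, pow_succ, Module.End.mul_apply,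
            Module.End.mul_apply, ← ih]; rfl
      ext z
      have hz : (LieModule.toEnd K I L x) z ∈ I := by
        change ⁅(x : L), z⁆ ∈ I
        exact lie_mem_left K L I x z x.2
      rw [pow_succ, Module.End.mul_apply]
      have := aux n ⟨_, hz⟩
      rw [hn] at this
      simpa using this
    · intro h x
      obtain ⟨n, hn⟩ := h x
      refine ⟨n, ?_⟩
      have aux : ∀ (k : ℕ) (y : I), ((LieModule.toEnd K I L x) ^ k) (y : L)
          = (((LieAlgebra.ad K I x) ^ k) y : I) := by
        intro k
        induction k with
        | zero => intro y; simp
        | succ k ih => intro y; rw [pow_succ, pow_succ, Module.End.mul_apply,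
            Module.End.mul_apply, ← ih]; rfl
      ext z
      rw [← aux n z, hn]
      simp
  rw [key, LieModule.isNilpotent_iff K]
  refine exists_congr fun k => ?_
  rw [← LieSubmodule.toSubmodule_inj, ← LieSubmodule.toSubmodule_inj,
    LieIdeal.coe_lcs_eq]
  simp

/-- The sum of two nilpotent ideals is nilpotent. -/
theorem idealNilpotent_sup {I J : LieIdeal K L} (hI : LieRing.IsNilpotent I)
    (hJ : LieRing.IsNilpotent J) : LieRing.IsNilpotent (I ⊔ J : LieIdeal K L) := by
  rw [idealNilpotent_iff_lcs] at *
  obtain ⟨a, ha⟩ := hI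
  obtain ⟨b, hb⟩ := hJ
  have key : ∀ n, (I ⊔ J).lcs L n ≤
      ⨆ (i : ℕ) (j : ℕ) (_ : i + j = n), I.lcs L i ⊓ J.lcs L j := by
    intro n
    induction n with
    | zero => exact le_iSup_of_le 0 (le_iSup_of_le 0 (le_iSup_of_le rfl (by simp)))
    | succ n ih =>
      rw [LieIdeal.lcs_succ]
      refine (LieSubmodule.mono_lie_right _ ih).trans ?_
      rw [LieSubmodule.sup_lie]
      refine sup_le
        (lie_iSup_le fun i => lie_iSup_le fun j => lie_iSup_le fun hij => ?_)
        (lie_iSup_le fun i => lie_iSup_le fun j => lie_iSup_le fun hij => ?_)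
      · refine le_iSup_of_le (i + 1) (le_iSup_of_le j (le_iSup_of_le (by omega) (le_inf ?_ ?_)))
        · rw [LieIdeal.lcs_succ]
          exact LieSubmodule.mono_lie_right _ inf_le_left
        · exact LieSubmodule.lie_le_right _ _ |>.trans inf_le_right
      · refine le_iSup_of_le i (le_iSup_of_le (j + 1) (le_iSup_of_le (by omega) (le_inf ?_ ?_)))
        · exact LieSubmodule.lie_le_right _ _ |>.trans inf_le_left
        · rw [LieIdeal.lcs_succ]
          exact LieSubmodule.mono_lie_right _ inf_le_right
  have anti : ∀ (I : LieIdeal K L) (k l : ℕ), k ≤ l → I.lcs L l ≤ I.lcs L k := by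
    intro I k l h
    induction h with
    | refl => exact le_rfl
    | step _ ih => rw [LieIdeal.lcs_succ]; exact (LieSubmodule.lie_le_right _ _).trans ih
  refine ⟨a + b, le_bot_iff.mp ((key _).trans ?_)⟩
  refine iSup_le fun i => iSup_le fun j => iSup_le fun hij => ?_
  rcases le_or_gt a i with h | h
  · exact inf_le_left.trans ((anti I a i h).trans ha.le)
  · exact inf_le_right.trans ((anti J b j (by omega)).trans hb.le)

/-- In a finite dimensional Lie algebra `nilradicalIdeal` is the greatest nilpotent ideal. -/
theorem nilradicalIdeal_isGreatest :
    IsGreatest {I : LieIdeal K L | LieRing.IsNilpotent I} (nilradicalIdeal K L) := by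
  refine ⟨?_, fun I hI => le_sSup hI⟩
  have hwf := LieSubmodule.wellFoundedGT_of_noetherian K L L
  rw [← CompleteLattice.isSupClosedCompact_iff_wellFoundedGT] at hwf
  refine hwf {I : LieIdeal K L | LieRing.IsNilpotent I} ⟨⊥, ?_⟩ fun I hI J hJ => ?_
  · change LieRing.IsNilpotent (⊥ : LieIdeal K L)
    infer_instance
  · exact idealNilpotent_sup hI hJ

end NilradicalFacts

section Graded

variable {K : Type*} [Field K]

/-- A `ℤ`-graded Lie algebra `g` is almost effective if no nonzero element of
`∑_{p ≥ 0} g_p` commutes with all of `∑_{p < 0} g_p`. -/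
def AlmostEffective {g : Type*} [LieRing g] [LieAlgebra K g] (𝓖 : ℤ → Submodule K g) : Prop :=
  ∀ X ∈ ⨆ (p : ℤ) (_ : 0 ≤ p), 𝓖 p,
    (∀ Y ∈ ⨆ (p : ℤ) (_ : p < 0), 𝓖 p, ⁅X, Y⁆ = 0) → X = 0

variable {m : Type*} [LieRing m] [LieAlgebra K m]

/-- A derivation is homogeneous of degree `0` if it preserves every homogeneous component. -/
def IsDegreeZero (𝓜 : ℤ → Submodule K m) (D : LieDerivation K m m) : Prop :=
  ∀ p : ℤ, ∀ x ∈ 𝓜 p, D x ∈ 𝓜 p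

/-- The representation `ρ` of a Lie algebra `g₀` of derivations of `m` on `m`. -/
def rho (g₀ : LieSubalgebra K (LieDerivation K m m)) (D : g₀) : Module.End K m :=
  (D : LieDerivation K m m).toLinearMap

/-- `Prolongation 𝓜 g₀ 𝓖` is the datum of a way to view the graded Lie algebra `(g, 𝓖)` as a
prolongation of type `g₀` of the graded Lie algebra `(m, 𝓜)`, where `g₀` is a Lie algebra of
derivations of `m`: embeddings of Lie algebras of `m` and `g₀` into `g`, which identify `m_p` with
`g_p` for all `p < 0`, and `g₀` with the degree `0` component of `g`, such that
`[D, x] = D(x)` for `D` in `g₀` and `x` in `m`. -/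
structure Prolongation (𝓜 : ℤ → Submodule K m)
    (g₀ : LieSubalgebra K (LieDerivation K m m))
    {g : Type*} [LieRing g] [LieAlgebra K g] (𝓖 : ℤ → Submodule K g) where
  inclNeg : m →ₗ⁅K⁆ g
  inclZero : g₀ →ₗ⁅K⁆ g
  inclNeg_injective : Function.Injective inclNeg
  inclZero_injective : Function.Injective inclZero
  map_inclNeg : ∀ p < 0, (𝓜 p).map (inclNeg : m →ₗ[K] g) = 𝓖 p
  range_inclZero : LinearMap.range (inclZero : g₀ →ₗ[K] g) = 𝓖 0
  lie_incl : ∀ (D : g₀) (x : m),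
    ⁅inclZero D, inclNeg x⁆ = inclNeg ((D : LieDerivation K m m) x)

variable {𝓜 : ℤ → Submodule K m} {g₀ : LieSubalgebra K (LieDerivation K m m)}
  {g : Type*} [LieRing g] [LieAlgebra K g] {𝓖 : ℤ → Submodule K g}

/-- The degree `0` part `n(g) ∩ g₀` of the maximal nilpotent ideal of `g`, as a subspace
of `g₀`. -/
def Prolongation.nilradicalZero (P : Prolongation 𝓜 g₀ 𝓖) : Submodule K g₀ :=
  (nilradicalIdeal K g).toSubmodule.comap (P.inclZero : g₀ →ₗ[K] g)

/-- The degree `0` part `r₀ = r ∩ g₀` of the solvable radical `r` of `g`, as a subspace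
of `g₀`. -/
def Prolongation.radicalZero (P : Prolongation 𝓜 g₀ 𝓖) : Submodule K g₀ :=
  (LieAlgebra.radical K g).toSubmodule.comap (P.inclZero : g₀ →ₗ[K] g)

end Graded

/-! The inclusions out of `n(g) ∩ g₀` are formal: the nilradical is solvable and acts nilpotently on
`g`, hence on `m`, and `r ∩ g₀` is a solvable ideal of `g₀`. Conversely, let `X ∈ rad(g₀)` with
`ρ(X)` nilpotent. First, `ad X` is nilpotent on `g`, by induction on the degree: if it is nilpotent
on lower degrees, the Leibniz rule makes a high power of `ad X` send `z ∈ g_p`, `p ≥ 0`, to an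
element centralizing `m`, which is zero by almost effectiveness
(`isNilpotent_ad_of_isNilpotent_rho`). Next, `X` is in the kernel of the Killing form: it is
orthogonal to `g_p`, `p ≠ 0`, for degree reasons, and to `g₀` because it lies in an ideal of `g₀`
acting nilpotently on `g` (`inclZero_mem_killingCompl`). That kernel is solvable, so `X ∈ r`.
Finally, `[g, r]` acts nilpotently, so `KX + [g, r]` is a nilpotent ideal containing `X`
(`mem_nilradicalIdeal_of_mem_radical`). The last description involves only `m` and `g₀`, whence
independence of `g`. -/

/-! ### Nilpotent actions, the solvable radical and the nilradical. -/

section LieTheory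

open LieAlgebra LieModule TensorProduct

/-- Over an algebraically closed field of characteristic zero, `⁅L, I⁆` acts nilpotently on every
finite dimensional representation of `L`, for each solvable ideal `I`. -/
theorem isNilpotent_toEnd_of_mem_lie_top_of_isAlgClosed {K L M : Type*} [Field K] [CharZero K]
    [IsAlgClosed K] [LieRing L] [LieAlgebra K L] (I : LieIdeal K L) [LieAlgebra.IsSolvable I]
    {z : L} (hz : z ∈ ⁅(⊤ : LieIdeal K L), I⁆)
    [AddCommGroup M] [Module K M] [LieRingModule L M] [LieModule K L M] [Module.Finite K M] :
    IsNilpotent (toEnd K L M z) := by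
  obtain _ | _ := subsingleton_or_nontrivial M
  · exact ⟨1, Subsingleton.elim _ _⟩
  -- Lie's theorem gives a weight of `I`; in characteristic zero its weight space is stable under
  -- all of `L`.
  obtain ⟨χ, hχ⟩ := exists_nontrivial_weightSpace_of_isSolvable K I M
  let N : LieSubmodule K L M := weightSpaceOfIsLieTower K M χ
  have hN : Nontrivial N := hχ
  have hact : ∀ x (hx : x ∈ I), ∀ n ∈ N, ⁅x, n⁆ = χ ⟨x, hx⟩ • n := by
    intro x hx n hn
    exact (mem_weightSpace χ n).mp hn ⟨x, hx⟩
  have hzI : z ∈ I := LieSubmodule.lie_le_right I ⊤ hz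
  -- `z` is a sum of commutators, so it has trace zero on `N`; it also acts there as the scalar `χ
  -- z`, which forces `χ z = 0`.
  have htr : LinearMap.trace K N (toEnd K L N z) = 0 := by
    have hz' : z ∈ (⁅(⊤ : LieIdeal K L), I⁆ : LieIdeal K L).toSubmodule := hz
    rw [LieSubmodule.lieIdeal_oper_eq_linear_span'] at hz'
    clear hz hzI
    induction hz' using Submodule.span_induction with
    | mem u hu => obtain ⟨a, -, b, -, rfl⟩ := hu; simp
    | zero => simp
    | add u v _ _ hu hv => simp_all
    | smul t u _ hu => simp_all
  have hsc : toEnd K L N z = χ ⟨z, hzI⟩ • LinearMap.id := by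
    ext n
    exact hact z hzI n n.2
  have hχz : χ ⟨z, hzI⟩ = 0 := by
    rw [hsc, map_smul, LinearMap.trace_id, smul_eq_mul, mul_eq_zero] at htr
    exact htr.resolve_right (Nat.cast_ne_zero.mpr Module.finrank_pos.ne')
  obtain ⟨k, hk⟩ := isNilpotent_toEnd_of_mem_lie_top_of_isAlgClosed I hz (M := M ⧸ N)
  refine ⟨k + 1, LinearMap.ext fun v => ?_⟩
  have hpow : ∀ j, LieSubmodule.Quotient.mk' N ((toEnd K L M z ^ j) v) =
      (toEnd K L (M ⧸ N) z ^ j) (LieSubmodule.Quotient.mk' N v) := by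
    intro j
    induction j with
    | zero => simp
    | succ j ih => rw [pow_succ', pow_succ', Module.End.mul_apply, Module.End.mul_apply, ← ih]; rfl
  have hmem : (toEnd K L M z ^ k) v ∈ N := by
    rw [← LieSubmodule.Quotient.mk_eq_zero, hpow, hk]
    rfl
  rw [pow_succ', Module.End.mul_apply, toEnd_apply_apply, hact z hzI _ hmem, hχz, zero_smul]
  rfl
termination_by Module.finrank K M
decreasing_by
  have h1 := Submodule.finrank_quotient_add_finrank N.toSubmodule
  have h2 : 0 < Module.finrank K N.toSubmodule := Module.finrank_pos (M := N)
  change Module.finrank K (M ⧸ N.toSubmodule) < _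
  omega

variable {K L M : Type*} [Field K] [LieRing L] [LieAlgebra K L]

theorem LieIdeal.isSolvable_baseChange (A : Type*) [CommRing A] [Algebra K A] (I : LieIdeal K L)
    [hI : LieAlgebra.IsSolvable I] : LieAlgebra.IsSolvable (LieSubmodule.baseChange A I :
      LieIdeal A (A ⊗[K] L)) := by
  obtain ⟨k, hk⟩ := IsSolvable.solvable K I
  rw [LieIdeal.derivedSeries_eq_bot_iff] at hk
  refine IsSolvable.mk (R := A) (k := k) ?_
  rw [LieIdeal.derivedSeries_eq_bot_iff]
  have : ∀ n, derivedSeriesOfIdeal A (A ⊗[K] L) n (LieSubmodule.baseChange A I) =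
      LieSubmodule.baseChange A (derivedSeriesOfIdeal K L n I) := by
    intro n
    induction n with
    | zero => simp
    | succ n ih => rw [derivedSeriesOfIdeal_succ, derivedSeriesOfIdeal_succ, ih,
        LieSubmodule.lie_baseChange]
  rw [this, hk, LieSubmodule.baseChange_bot]

variable [AddCommGroup M] [Module K M] [LieRingModule L M] [LieModule K L M]

/-- In characteristic zero, `⁅L, I⁆` acts nilpotently on every finite dimensional representation
of `L`, for each solvable ideal `I`. -/
theorem isNilpotent_toEnd_of_mem_lie_top [CharZero K] [Module.Finite K M]
    (I : LieIdeal K L) [LieAlgebra.IsSolvable I]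
    {z : L} (hz : z ∈ ⁅(⊤ : LieIdeal K L), I⁆) :
    IsNilpotent (toEnd K L M z) := by
  let A := AlgebraicClosure K
  have := LieIdeal.isSolvable_baseChange A I
  have : CharZero A := algebraRat.charZero A
  have hzA : (1 : A) ⊗ₜ[K] z ∈
      ⁅(⊤ : LieIdeal A (A ⊗[K] L)), (LieSubmodule.baseChange A I : LieIdeal A (A ⊗[K] L))⁆ := by
    rw [← LieSubmodule.baseChange_top, ← LieSubmodule.lie_baseChange]
    exact Submodule.tmul_mem_baseChange_of_mem 1 hz
  have h := isNilpotent_toEnd_of_mem_lie_top_of_isAlgClosed (M := A ⊗[K] M) _ hzA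
  rw [toEnd_baseChange] at h
  exact (IsNilpotent.map_iff (f := Module.End.baseChangeHom K A M)
    (LinearMap.baseChangeHom_injective K M A)).mp h

theorem LieModule.exists_lcs_eq_bot (I : LieIdeal K L) [LieModule.IsNilpotent I M] :
    ∃ k, I.lcs M k = ⊥ := by
  obtain ⟨k, hk⟩ := IsNilpotent.nilpotent K I M
  exact ⟨k, by simp only [← LieSubmodule.toSubmodule_inj, I.coe_lcs_eq, hk,
    LieSubmodule.bot_toSubmodule]⟩

/-- Perturbing a nilpotent operator by an element of an ideal that acts nilpotently gives a
nilpotent operator. -/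
theorem isNilpotent_toEnd_add_of_mem (I : LieIdeal K L) [LieModule.IsNilpotent I M] {x y : L}
    (hx : IsNilpotent (toEnd K L M x)) (hy : y ∈ I) :
    IsNilpotent (toEnd K L M (x + y)) := by
  obtain ⟨n, hn⟩ := hx
  obtain ⟨k, hk⟩ := LieModule.exists_lcs_eq_bot (K := K) (M := M) I
  have mem : ∀ w j v, v ∈ I.lcs M j → ∀ i, (toEnd K L M w ^ i) v ∈ I.lcs M j := by
    intro w j v hv i
    induction i with
    | zero => simpa
    | succ i ih =>
      rw [pow_succ', Module.End.mul_apply]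
      exact LieSubmodule.lie_mem _ ih
  -- Powers of `x + y` and `x` agree modulo the next term of the filtration, so `(x + y) ^ n` moves
  -- down one step once `x ^ n = 0`.
  have diff : ∀ j v, v ∈ I.lcs M j → ∀ i,
      (toEnd K L M (x + y) ^ i) v - (toEnd K L M x ^ i) v ∈ I.lcs M (j + 1) := by
    intro j v hv i
    induction i with
    | zero => simp
    | succ i ih =>
      have e : (toEnd K L M (x + y) ^ (i + 1)) v - (toEnd K L M x ^ (i + 1)) v =
          ⁅x, (toEnd K L M (x + y) ^ i) v - (toEnd K L M x ^ i) v⁆ +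
            ⁅y, (toEnd K L M (x + y) ^ i) v⁆ := by
        simp only [pow_succ', Module.End.mul_apply, toEnd_apply_apply, add_lie, lie_sub]
        abel
      rw [e]
      refine add_mem (LieSubmodule.lie_mem _ ih) ?_
      rw [LieIdeal.lcs_succ]
      exact LieSubmodule.lie_mem_lie hy (mem _ _ _ hv _)
  have key : ∀ j v, (toEnd K L M (x + y) ^ (n * j)) v ∈ I.lcs M j := by
    intro j v
    induction j with
    | zero => simp
    | succ j ih =>
      rw [Nat.mul_succ, add_comm (n * j) n, pow_add, Module.End.mul_apply]
      simpa only [hn, LinearMap.zero_apply, sub_zero] using diff j _ ih n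
  refine ⟨n * k, LinearMap.ext fun v => ?_⟩
  simpa [hk] using key k v

/-- An ideal that acts nilpotently is orthogonal to the whole Lie algebra for the trace form. -/
theorem traceForm_eq_zero_of_mem_of_isNilpotent (I : LieIdeal K L)
    [LieModule.IsNilpotent I M] {x : L} (hx : x ∈ I) (y : L) : traceForm K L M x y = 0 := by
  obtain ⟨k, hk⟩ := LieModule.exists_lcs_eq_bot (K := K) (M := M) I
  rw [traceForm_apply_apply]
  refine (LinearMap.isNilpotent_trace_of_isNilpotent ⟨k, LinearMap.ext fun v => ?_⟩).eq_zero
  -- `y` preserves each term of the filtration and `x` sends it into the next.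
  have : ∀ j, ((toEnd K L M x ∘ₗ toEnd K L M y) ^ j) v ∈ I.lcs M j := by
    intro j
    induction j with
    | zero => simp
    | succ j ih =>
      rw [pow_succ', Module.End.mul_apply, LieIdeal.lcs_succ]
      exact LieSubmodule.lie_mem_lie hx (LieSubmodule.lie_mem _ ih)
  simpa [hk] using this k

/-- In characteristic zero, an element of the radical that acts nilpotently on a finite
dimensional representation lies in an ideal that acts nilpotently. -/
theorem exists_lieIdeal_isNilpotent_of_mem_radical [CharZero K] [FiniteDimensional K L]
    [Module.Finite K M] {x : L} (hx : x ∈ radical K L) (hn : IsNilpotent (toEnd K L M x)) :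
    ∃ I : LieIdeal K L, x ∈ I ∧ LieModule.IsNilpotent I M := by
  let D : LieIdeal K L := ⁅(⊤ : LieIdeal K L), radical K L⁆
  have hD : LieModule.IsNilpotent D M :=
    (LieModule.isNilpotent_iff_forall' (R := K)).mpr fun z =>
      isNilpotent_toEnd_of_mem_lie_top (radical K L) z.2
  -- The line through `x` need not be an ideal, but `⁅L, x⁆` lies in `D`.
  let I : LieIdeal K L :=
    { (K ∙ x) ⊔ D.toSubmodule with
      lie_mem := by
        intro y z hz
        obtain ⟨u, hu, d, hd, rfl⟩ := Submodule.mem_sup.mp hz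
        obtain ⟨c, rfl⟩ := Submodule.mem_span_singleton.mp hu
        refine Submodule.mem_sup_right ?_
        rw [lie_add, lie_smul]
        exact D.add_mem (D.smul_mem _ (LieSubmodule.lie_mem_lie (LieSubmodule.mem_top y) hx))
          (D.lie_mem hd) }
  refine ⟨I, Submodule.mem_sup_left (Submodule.mem_span_singleton_self x),
    (LieModule.isNilpotent_iff_forall' (R := K)).mpr ?_⟩
  rintro ⟨z, hz⟩
  obtain ⟨u, hu, d, hd, rfl⟩ := Submodule.mem_sup.mp hz
  obtain ⟨c, rfl⟩ := Submodule.mem_span_singleton.mp hu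
  refine isNilpotent_toEnd_add_of_mem D ?_ hd
  rw [map_smul]
  exact hn.smul c

/-- In characteristic zero, the ad-nilpotent elements of the radical are in the nilradical. -/
theorem mem_nilradicalIdeal_of_mem_radical [CharZero K] [FiniteDimensional K L]
    {x : L} (hx : x ∈ radical K L) (hn : IsNilpotent (ad K L x)) :
    x ∈ nilradicalIdeal K L := by
  obtain ⟨I, hxI, hI⟩ := exists_lieIdeal_isNilpotent_of_mem_radical (M := L) hx hn
  refine (le_sSup (a := I) ?_ : I ≤ nilradicalIdeal K L) hxI
  exact (idealNilpotent_iff_lcs I).mpr (LieModule.exists_lcs_eq_bot I)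

theorem nilradicalIdeal_le_radical [FiniteDimensional K L] :
    nilradicalIdeal K L ≤ radical K L := by
  have h : LieRing.IsNilpotent (nilradicalIdeal K L) := nilradicalIdeal_isGreatest.1
  exact (LieIdeal.solvable_iff_le_radical K L _).mp inferInstance

theorem isNilpotent_ad_of_mem_nilradicalIdeal [FiniteDimensional K L] {x : L}
    (hx : x ∈ nilradicalIdeal K L) : IsNilpotent (ad K L x) := by
  obtain ⟨k, hk⟩ := (idealNilpotent_iff_lcs _).mp (nilradicalIdeal_isGreatest (K := K) (L := L)).1
  refine ⟨k, LinearMap.ext fun v => ?_⟩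
  have : ∀ j, (ad K L x ^ j) v ∈ (nilradicalIdeal K L).lcs L j := by
    intro j
    induction j with
    | zero => simp
    | succ j ih =>
      rw [pow_succ', Module.End.mul_apply, LieIdeal.lcs_succ]
      exact LieSubmodule.lie_mem_lie hx ih
  simpa [hk] using this k

end LieTheory

/-! ### Prolongations: degree arguments and the degree zero part of the nilradical. -/

section GradedTheory

open LieAlgebra LieModule

variable {K : Type*} [Field K] {m : Type*} [LieRing m] [LieAlgebra K m]
  {g : Type*} [LieRing g] [LieAlgebra K g]

/-- If `ad x` is nilpotent on `U`, and on the span of all `⁅z, y⁆` with `y ∈ U`, then some power of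
`ad x` maps `z` to the centralizer of `U`. -/
theorem exists_lie_ad_pow_apply_eq_zero {U : Submodule K g} {x z : g} {a b : ℕ}
    (hxU : ∀ y ∈ U, ⁅x, y⁆ ∈ U) (ha : ∀ y ∈ U, (ad K g x ^ a) y = 0)
    (hb : ∀ y ∈ U, (ad K g x ^ b) ⁅z, y⁆ = 0) :
    ∀ y ∈ U, ⁅(ad K g x ^ (a + b)) z, y⁆ = 0 := by
  have hstab : ∀ j, ∀ y ∈ U, (ad K g x ^ j) y ∈ U := by
    intro j y hy
    induction j with
    | zero => simpa
    | succ j ih => rw [pow_succ', Module.End.mul_apply]; exact hxU _ ih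
  -- Leibniz trades a power on `z` for one outside the bracket or one on `y`, keeping the total. At
  -- `n = 0`, either `j ≥ a` or `i ≥ b`.
  have key : ∀ n i j, a + b ≤ n + i + j → ∀ y ∈ U,
      (ad K g x ^ i) ⁅(ad K g x ^ n) z, (ad K g x ^ j) y⁆ = 0 := by
    intro n
    induction n with
    | zero =>
      intro i j h y hy
      rcases le_or_gt a j with hj | hj
      · obtain ⟨c, rfl⟩ := Nat.exists_eq_add_of_le' hj
        rw [pow_add _ c a, Module.End.mul_apply, ha y hy]
        simp
      · obtain ⟨c, rfl⟩ := Nat.exists_eq_add_of_le' (show b ≤ i by omega)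
        rw [pow_add _ c b, Module.End.mul_apply, pow_zero, Module.End.one_apply,
          hb _ (hstab j y hy), map_zero]
    | succ n ih =>
      intro i j h y hy
      have e : ⁅(ad K g x ^ (n + 1)) z, (ad K g x ^ j) y⁆ =
          ad K g x ⁅(ad K g x ^ n) z, (ad K g x ^ j) y⁆ -
            ⁅(ad K g x ^ n) z, (ad K g x ^ (j + 1)) y⁆ := by
        rw [pow_succ', pow_succ', Module.End.mul_apply, Module.End.mul_apply, ad_apply, ad_apply,
          ad_apply, leibniz_lie x]
        abel
      rw [e, map_sub, ← Module.End.mul_apply, ← pow_succ, ih _ _ (by omega) y hy,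
        ih _ _ (by omega) y hy, sub_zero]
  intro y hy
  simpa using key (a + b) 0 0 le_rfl y hy

variable {𝓜 : ℤ → Submodule K m} {g₀ : LieSubalgebra K (LieDerivation K m m)}
  {𝓖 : ℤ → Submodule K g}

namespace Prolongation

theorem inclZero_mem (P : Prolongation 𝓜 g₀ 𝓖) (X : g₀) : P.inclZero X ∈ 𝓖 0 := by
  rw [← P.range_inclZero]
  exact ⟨X, rfl⟩

theorem ad_pow_inclNeg (P : Prolongation 𝓜 g₀ 𝓖) (X : g₀) (k : ℕ) (x : m) :
    (ad K g (P.inclZero X) ^ k) (P.inclNeg x) = P.inclNeg ((rho g₀ X ^ k) x) := by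
  induction k with
  | zero => simp
  | succ k ih =>
    rw [pow_succ', pow_succ', Module.End.mul_apply, Module.End.mul_apply, ih]
    exact P.lie_incl X _

theorem isNilpotent_rho (P : Prolongation 𝓜 g₀ 𝓖) {X : g₀}
    (h : IsNilpotent (ad K g (P.inclZero X))) : IsNilpotent (rho g₀ X) := by
  obtain ⟨k, hk⟩ := h
  refine ⟨k, LinearMap.ext fun x => P.inclNeg_injective ?_⟩
  rw [← P.ad_pow_inclNeg, hk]
  simp

theorem radicalZero_le_radical [FiniteDimensional K g] (P : Prolongation 𝓜 g₀ 𝓖) :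
    P.radicalZero ≤ (radical K g₀).toSubmodule := by
  have : FiniteDimensional K g₀ :=
    FiniteDimensional.of_injective (P.inclZero : g₀ →ₗ[K] g) P.inclZero_injective
  let I : LieIdeal K g₀ := (radical K g).comap P.inclZero
  let f : I →ₗ⁅K⁆ radical K g :=
    { toFun := fun x => ⟨P.inclZero x, LieIdeal.mem_comap.mp x.2⟩
      map_add' := fun x y => by ext; simp
      map_smul' := fun c x => by ext; simp
      map_lie' := fun {x y} => by ext; simp }
  have hf : Function.Injective f := fun x y hxy =>
    Subtype.ext (P.inclZero_injective (congrArg Subtype.val hxy))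
  have hI : LieAlgebra.IsSolvable I := hf.lieAlgebra_isSolvable
  exact (LieIdeal.solvable_iff_le_radical K g₀ I).mp hI

theorem iSup_neg_eq_range [GradedLieAlgebra 𝓜] (h𝓜 : ∀ p : ℤ, 0 ≤ p → 𝓜 p = ⊥)
    (P : Prolongation 𝓜 g₀ 𝓖) :
    ⨆ (p : ℤ) (_ : p < 0), 𝓖 p = LinearMap.range (P.inclNeg : m →ₗ[K] g) := by
  have htop : ⨆ p, 𝓜 p = ⊤ := (DirectSum.Decomposition.isInternal 𝓜).submodule_iSup_eq_top
  rw [LinearMap.range_eq_map, ← htop, Submodule.map_iSup]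
  refine iSup_congr fun p => ?_
  by_cases hp : p < 0
  · simp [hp, P.map_inclNeg]
  · simp [hp, h𝓜 p (not_lt.mp hp)]

/-- In an almost effective prolongation, the elements of `g₀` that act nilpotently on `m` act
nilpotently on the whole prolongation. -/
theorem isNilpotent_ad_of_isNilpotent_rho [FiniteDimensional K g] [GradedLieAlgebra 𝓜]
    (h𝓜 : ∀ p : ℤ, 0 ≤ p → 𝓜 p = ⊥) [GradedLieAlgebra 𝓖] (P : Prolongation 𝓜 g₀ 𝓖)
    (hP : AlmostEffective 𝓖) {X : g₀} (hX : IsNilpotent (rho g₀ X)) :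
    IsNilpotent (ad K g (P.inclZero X)) := by
  obtain ⟨a, ha⟩ := hX
  set T := ad K g (P.inclZero X) with hT
  set E := T.maxGenEigenspace 0 with hE
  have memE : ∀ z, z ∈ E ↔ ∃ k, (T ^ k) z = 0 := by
    intro z
    rw [hE, Module.End.mem_maxGenEigenspace, zero_smul, sub_zero]
  -- Finite dimension makes the exponent uniform on `E`, as the Leibniz argument needs.
  obtain ⟨b, hb⟩ : ∃ b, ∀ z ∈ E, (T ^ b) z = 0 := by
    refine ⟨Module.finrank K g, fun z hz => ?_⟩
    rw [hE, Module.End.maxGenEigenspace_eq_genEigenspace_finrank] at hz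
    simpa using hz
  set U := ⨆ (p : ℤ) (_ : p < 0), 𝓖 p with hU
  have hUr := P.iSup_neg_eq_range h𝓜
  rw [← hU] at hUr
  have haU : ∀ y ∈ U, (T ^ a) y = 0 := by
    intro y hy
    rw [hUr] at hy
    obtain ⟨x, rfl⟩ := hy
    have := P.ad_pow_inclNeg X a x
    rw [ha] at this
    simpa using this
  have hXU : ∀ y ∈ U, ⁅P.inclZero X, y⁆ ∈ U := by
    intro y hy
    rw [hUr] at hy ⊢
    obtain ⟨x, rfl⟩ := hy
    exact ⟨_, (P.lie_incl X x).symm⟩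
  have hstab : ∀ p k, ∀ z ∈ 𝓖 p, (T ^ k) z ∈ 𝓖 p := by
    intro p k z hz
    induction k with
    | zero => simpa
    | succ k ih =>
      rw [pow_succ', Module.End.mul_apply]
      simpa only [zero_add, hT, ad_apply] using
        SetLike.GradedBracket.bracket_mem (P.inclZero_mem X) ih
  have main : ∀ n : ℕ, ∀ p : ℤ, p < n → 𝓖 p ≤ E := by
    intro n
    induction n with
    | zero =>
      intro p hp z hz
      exact (memE z).mpr ⟨a, haU z (le_iSup₂_of_le (f := fun (p : ℤ) (_ : p < 0) => 𝓖 p)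
        p (by simpa using hp) le_rfl hz)⟩
    | succ n ih =>
      intro p hp z hz
      rcases lt_or_ge p n with h | h
      · exact ih p h hz
      -- Bracketing with negative degrees lowers the degree of `z`, so the induction hypothesis
      -- applies.
      have hzU : ∀ y ∈ U, ⁅z, y⁆ ∈ E := by
        have : U ≤ E.comap (ad K g z) := by
          refine iSup₂_le fun q hq y hy => ?_
          exact ih (p + q) (by push_cast at hp; omega) (SetLike.GradedBracket.bracket_mem hz hy)
        exact fun y hy => this hy
      refine (memE z).mpr ⟨a + b, hP _ ?_ ?_⟩
      · exact le_iSup₂_of_le (f := fun (p : ℤ) (_ : 0 ≤ p) => 𝓖 p) p (by omega) le_rfl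
          (hstab p _ z hz)
      · exact exists_lie_ad_pow_apply_eq_zero hXU haU fun y hy => hb _ (hzU y hy)
  have hEtop : E = ⊤ := by
    rw [eq_top_iff, ← (DirectSum.Decomposition.isInternal 𝓖).submodule_iSup_eq_top]
    exact iSup_le fun p => main (p.toNat + 1) p (by omega)
  exact ⟨b, LinearMap.ext fun z => hb z (hEtop ▸ Submodule.mem_top)⟩

/-- Elements of the radical of `g₀` that are ad-nilpotent on the prolongation are in the kernel
of its Killing form. -/
theorem inclZero_mem_killingCompl [CharZero K] [FiniteDimensional K g] [GradedLieAlgebra 𝓖]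
    (P : Prolongation 𝓜 g₀ 𝓖) {X : g₀} (hX : X ∈ radical K g₀)
    (hn : IsNilpotent (ad K g (P.inclZero X))) :
    P.inclZero X ∈ LieIdeal.killingCompl K g ⊤ := by
  have : FiniteDimensional K g₀ :=
    FiniteDimensional.of_injective (P.inclZero : g₀ →ₗ[K] g) P.inclZero_injective
  have hzero : ∀ Y : g₀, killingForm K g (P.inclZero X) (P.inclZero Y) = 0 := by
    -- With `g` viewed as a `g₀`-module, its trace form is the Killing form of `g` restricted to
    -- `g₀`.
    let _ : LieRingModule g₀ g := LieRingModule.compLieHom g P.inclZero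
    let _ : LieModule K g₀ g := LieModule.compLieHom g P.inclZero
    obtain ⟨I, hXI, hI⟩ := exists_lieIdeal_isNilpotent_of_mem_radical (M := g) hX hn
    exact fun Y => traceForm_eq_zero_of_mem_of_isNilpotent I hXI Y
  have hhom : ∀ p, ∀ z ∈ 𝓖 p, killingForm K g (P.inclZero X) z = 0 := by
    intro p z hz
    rcases eq_or_ne p 0 with rfl | hp
    · rw [← P.range_inclZero] at hz
      obtain ⟨Y, rfl⟩ := hz
      exact hzero Y
    · rw [killingForm_apply_apply]
      -- The composite of `ad X` and `ad z` shifts degrees by `p ≠ 0`, so it has no diagonal blocks.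
      refine LinearMap.trace_eq_zero_of_mapsTo_ne (DirectSum.Decomposition.isInternal 𝓖)
        (fun q => 0 + (p + q)) (fun q => by omega) fun q v hv => ?_
      exact SetLike.GradedBracket.bracket_mem (P.inclZero_mem X)
        (SetLike.GradedBracket.bracket_mem hz hv)
  rw [LieIdeal.mem_killingCompl]
  intro z _
  rw [LieModule.traceForm_comm]
  have : (⊤ : Submodule K g) ≤ LinearMap.ker (killingForm K g (P.inclZero X)) := by
    rw [← (DirectSum.Decomposition.isInternal 𝓖).submodule_iSup_eq_top]
    exact iSup_le fun p z hz => hhom p z hz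
  exact this (Submodule.mem_top (x := z))

theorem nilradicalZero_le [FiniteDimensional K g] (P : Prolongation 𝓜 g₀ 𝓖) {X : g₀}
    (hX : X ∈ P.nilradicalZero) : X ∈ P.radicalZero ∧ IsNilpotent (rho g₀ X) :=
  ⟨nilradicalIdeal_le_radical (K := K) (L := g) hX,
    P.isNilpotent_rho (isNilpotent_ad_of_mem_nilradicalIdeal hX)⟩

theorem mem_nilradicalZero_iff [CharZero K] [FiniteDimensional K g] [GradedLieAlgebra 𝓜]
    (h𝓜 : ∀ p : ℤ, 0 ≤ p → 𝓜 p = ⊥) [GradedLieAlgebra 𝓖] (P : Prolongation 𝓜 g₀ 𝓖)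
    (hP : AlmostEffective 𝓖) (X : g₀) :
    X ∈ P.nilradicalZero ↔ X ∈ radical K g₀ ∧ IsNilpotent (rho g₀ X) := by
  constructor
  · intro h
    obtain ⟨h₁, h₂⟩ := P.nilradicalZero_le h
    exact ⟨P.radicalZero_le_radical h₁, h₂⟩
  · rintro ⟨h₁, h₂⟩
    have hn := P.isNilpotent_ad_of_isNilpotent_rho h𝓜 hP h₂
    exact mem_nilradicalIdeal_of_mem_radical
      (killingCompl_top_le_radical K g (P.inclZero_mem_killingCompl h₁ hn)) hn

end Prolongation

end GradedTheory

theorem mainTheorem5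
    {K : Type*} [Field K] [CharZero K]
    {m : Type*} [LieRing m] [LieAlgebra K m] [FiniteDimensional K m] [LieRing.IsNilpotent m]
    (𝓜 : ℤ → Submodule K m) [GradedLieAlgebra 𝓜] (h𝓜 : ∀ p : ℤ, 0 ≤ p → 𝓜 p = ⊥)
    (g₀ : LieSubalgebra K (LieDerivation K m m)) (hg₀ : ∀ D ∈ g₀, IsDegreeZero 𝓜 D)
    {g : Type*} [LieRing g] [LieAlgebra K g] [FiniteDimensional K g]
    (𝓖 : ℤ → Submodule K g) [GradedLieAlgebra 𝓖]
    (P : Prolongation 𝓜 g₀ 𝓖) (hP : AlmostEffective 𝓖) :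
    (P.nilradicalZero : Set g₀) = {X : g₀ | X ∈ P.radicalZero ∧ IsNilpotent (rho g₀ X)} ∧
    (P.nilradicalZero : Set g₀) =
      {X : g₀ | X ∈ LieAlgebra.radical K g₀ ∧ IsNilpotent (rho g₀ X)} ∧
    ∀ {g' : Type*} [LieRing g'] [LieAlgebra K g'] [FiniteDimensional K g']
      (𝓖' : ℤ → Submodule K g') [GradedLieAlgebra 𝓖']
      (P' : Prolongation 𝓜 g₀ 𝓖'), AlmostEffective 𝓖' →
        P'.nilradicalZero = P.nilradicalZero := by
  refine ⟨Set.ext fun X => ⟨P.nilradicalZero_le, fun h => ?_⟩,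
    Set.ext (P.mem_nilradicalZero_iff h𝓜 hP), ?_⟩
  · exact (P.mem_nilradicalZero_iff h𝓜 hP X).mpr ⟨P.radicalZero_le_radical h.1, h.2⟩
  · intro g' _ _ _ 𝓖' _ P' hP'
    ext X
    rw [P'.mem_nilradicalZero_iff h𝓜 hP', P.mem_nilradicalZero_iff h𝓜 hP]
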